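/- Write $T_n=n(n+1)/2$, $(a;q)_N=\prod_{k=0}^{N-1}(1-aq^k)$, $(a;q)_\infty=\lim_{N\to\infty}(a;q)_N$ and $(a,b,c;q)_\infty=(a;q)_\infty(b;q)_\infty(c;q)_\infty$. Then $$\sum_{i,j\ge 0}(-1)^i q^{T_{i+j}+i}\frac{(AB;q)_i}{(q;q)_i}\left\{\frac{A^{1+j}}{1+A}+\frac{B^{1+j}}{1+B}\right\}+\frac{1-AB}{(1+A)(1+B)}\sum_{i,j\ge 0}(-1)^{i+j}q^{T_{i+j}+i}\frac{(AB;q)_i}{(q;q)_i}=(-Aq,-Bq,q;q)_\infty ,$$ where all the sums and limits involved converge, in each of the following two settings: (a) as an identity of formal power series in $q$ over an arbitrary field $K$, for all $A,B\in K\setminus\{-1\}$ (for instance, $A,B$ indeterminates and $K=\mathbb{Q}(A,B)$), with coefficientwise convergence; (b) for all complex numbers $A,B,q$ with $A,B\ne -1$ and $|q|<1$. Moreover, in both settings, for $z\ne 0,-1$ the specialization $A=z$, $B=1/z$ reduces the left side to the single (convergent) sum $\sum_{j\ge 0}q^{T_j}\frac{z^{-j}+z^{1+j}}{1+z}$, so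 that the identity becomes Jacobi's triple product identity $$\sum_{j\ge 0}q^{T_j}\,\frac{z^{-j}+z^{1+j}}{1+z}=(-qz,-qz^{-1},q;q)_\infty .$$ -/

import Mathlib

open Filter Topology
open scoped PowerSeries PowerSeries.WithPiTopology

/-- The triangular number `T_n = n (n + 1) / 2` (the division is exact). -/
def triangular (n : ℕ) : ℕ := n * (n + 1) / 2

/-- The finite `q`-Pochhammer symbol `(a; q)_N = ∏_{k < N} (1 - a q^k)`. -/
def qPoch {S : Type*} [CommRing S] (a q : S) (N : ℕ) : S :=
  ∏ k ∈ Finset.range N, (1 - a * q ^ k)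

/-- The infinite `q`-Pochhammer symbol `(a; q)_∞ = lim_{N → ∞} (a; q)_N`. -/
noncomputable def qPochInf {S : Type*} [CommRing S] [TopologicalSpace S] (a q : S) : S :=
  limUnder atTop (fun N : ℕ => qPoch a q N)

/-- The `(i, j)` term of the first double sum,
`(-1)^i q^{T_{i+j}+i} (AB; q)_i / (q; q)_i * (A^{1+j} / (1 + A) + B^{1+j} / (1 + B))`.
It is used in `ℂ` and in `K⟦X⟧` (with `q = X`), where `⁻¹` is a true inverse of the elements
it is applied to. -/
def firstTerm {S : Type*} [CommRing S] [Inv S] (A B q : S) (p : ℕ × ℕ) : S :=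
  (-1) ^ p.1 * q ^ (triangular (p.1 + p.2) + p.1) *
    (qPoch (A * B) q p.1 * (qPoch q q p.1)⁻¹) *
    (A ^ (1 + p.2) * (1 + A)⁻¹ + B ^ (1 + p.2) * (1 + B)⁻¹)

/-- The `(i, j)` term of the second double sum,
`(-1)^{i+j} q^{T_{i+j}+i} (AB; q)_i / (q; q)_i`. -/
def secondTerm {S : Type*} [CommRing S] [Inv S] (A B q : S) (p : ℕ × ℕ) : S :=
  (-1) ^ (p.1 + p.2) * q ^ (triangular (p.1 + p.2) + p.1) *
    (qPoch (A * B) q p.1 * (qPoch q q p.1)⁻¹)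

/-- The left side of the two-parameter identity: the first double sum plus
`(1 - AB) / ((1 + A) (1 + B))` times the second one. -/
noncomputable def twoParamSum {S : Type*} [CommRing S] [Inv S] [TopologicalSpace S]
    (A B q : S) : S :=
  (∑' p : ℕ × ℕ, firstTerm A B q p) +
    (1 - A * B) * ((1 + A)⁻¹ * (1 + B)⁻¹) * ∑' p : ℕ × ℕ, secondTerm A B q p

/-- The `j`-th term `q^{T_j} (z^{-j} + z^{1+j}) / (1 + z)` of Jacobi's sum. -/
def jacobiTerm {S : Type*} [CommRing S] [Inv S] (z q : S) (j : ℕ) : S :=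
  q ^ triangular j * (((z⁻¹) ^ j + z ^ (1 + j)) * (1 + z)⁻¹)

/-! Write e_n = 1/(q;q)_n. Euler's expansion (yq;q)_∞ = Σ (-y)^n q^{T_n} e_n (`tendsto_qPoch`) turns
(-Aq;q)_∞ (-Bq;q)_∞ into a double series in A^m B^n. Grouping by d = |m - n| (`eulerSeries_mul`)
gives J_0 + Σ_{d≥1} (A^d + B^d) J_d, where J_d (`besselSeries`) depends on A, B only through AB. The
key relation is (q;q)_∞ (J_d + J_{d+1}) = H_d (`besselSeries_add_succ`), where H_d (`heineSeries`)
is the inner i-sum of the theorem at j = d. It rests on (q;q)_∞ e_M = (q^{M+1};q)_∞ and the finite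
q-binomial theorem. If u_0 = 1 and u_{j+1} + u_j = A^{j+1} + B^{j+1}, then Σ u_j H_j regroups to
(q;q)_∞ times the product above (`tsum_mul_heineSeries`). Solving this recursion gives u_j =
A^{1+j}/(1+A) + B^{1+j}/(1+B) + (-1)^j (1-AB)/((1+A)(1+B)), which is exactly the left side. Both
settings are treated at once through an abstract norm `w`: the absolute value on ℂ, the X-adic one
on K⟦X⟧. For AB = 1 the factor (1;q)_i kills every term with i > 0, leaving Jacobi's sum. -/

theorem triangular_succ (n : ℕ) : triangular (n + 1) = triangular n + (n + 1) := by
  unfold triangular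
  rw [show (n + 1) * (n + 1 + 1) = n * (n + 1) + (n + 1) * 2 by ring,
    Nat.add_mul_div_right _ _ two_pos]

@[simp]
theorem triangular_zero : triangular 0 = 0 := rfl

theorem triangular_add (a b : ℕ) : triangular (a + b) = triangular a + triangular b + a * b := by
  induction b with
  | zero => simp
  | succ b ih => rw [← add_assoc, triangular_succ, ih, triangular_succ]; ring

theorem qPoch_zero {S : Type*} [CommRing S] (a q : S) : qPoch a q 0 = 1 := by
  simp [qPoch]

theorem qPoch_succ {S : Type*} [CommRing S] (a q : S) (N : ℕ) :
    qPoch a q (N + 1) = qPoch a q N * (1 - a * q ^ N) := by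
  simp [qPoch, Finset.prod_range_succ]

theorem Real.summable_pow_mul_pow_triangular (K : ℝ) {r : ℝ} (h0 : 0 ≤ r) (h1 : r < 1) :
    Summable fun n : ℕ => K ^ n * r ^ triangular n := by
  refine summable_of_ratio_norm_eventually_le (r := 1 / 2) (by norm_num) ?_
  have ht : Tendsto (fun n : ℕ => |K| * r ^ (n + 1)) atTop (𝓝 (|K| * 0)) :=
    ((tendsto_pow_atTop_nhds_zero_of_lt_one h0 h1).comp (tendsto_add_atTop_nat 1)).const_mul _
  rw [mul_zero] at ht
  filter_upwards [ht.eventually_le_const (show (0 : ℝ) < 1 / 2 by norm_num)] with n hn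
  have : K ^ (n + 1) * r ^ triangular (n + 1) = (K * r ^ (n + 1)) * (K ^ n * r ^ triangular n) := by
    rw [triangular_succ]; ring
  rw [this, norm_mul]
  refine mul_le_mul_of_nonneg_right ?_ (norm_nonneg _)
  rwa [norm_mul, Real.norm_eq_abs, Real.norm_of_nonneg (pow_nonneg h0 _)]

/-! ### Abstract norms, geometric growth and summability -/

/-- A submultiplicative length function on a topological ring for which every absolutely summable
family is summable. -/
structure IsSummabilityNorm {S : Type*} [CommRing S] [TopologicalSpace S] (w : S → ℝ) : Prop where
  nonneg : ∀ x, 0 ≤ w x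
  add_le : ∀ x y, w (x + y) ≤ w x + w y
  mul_le : ∀ x y, w (x * y) ≤ w x * w y
  neg_le : ∀ x, w (-x) ≤ w x
  one_le : w 1 ≤ 1
  summable : ∀ {ι : Type} (f : ι → S), Summable (fun i => w (f i)) → Summable f

/-- A sequence grows at most geometrically with respect to `w`. -/
def GeomGrowth {S : Type*} (w : S → ℝ) (a : ℕ → S) : Prop :=
  ∃ M K : ℝ, 0 ≤ M ∧ 1 ≤ K ∧ ∀ n, w (a n) ≤ M * K ^ n

/-- A double sequence grows at most geometrically with respect to `w`. -/
def GeomGrowth₂ {S : Type*} (w : S → ℝ) (f : ℕ × ℕ → S) : Prop :=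
  ∃ M K : ℝ, 0 ≤ M ∧ 1 ≤ K ∧ ∀ p, w (f p) ≤ M * K ^ (p.1 + p.2)

namespace IsSummabilityNorm

variable {S : Type*} [CommRing S] [TopologicalSpace S] {w : S → ℝ}

theorem pow_le (hw : IsSummabilityNorm w) (x : S) (n : ℕ) : w (x ^ n) ≤ w x ^ n := by
  induction n with
  | zero => simpa using hw.one_le
  | succ n ih =>
    rw [pow_succ, pow_succ]
    exact (hw.mul_le _ _).trans (mul_le_mul_of_nonneg_right ih (hw.nonneg _))

theorem one_sub_mul_pow_le (hw : IsSummabilityNorm w) (a q : S) (k : ℕ) :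
    w (1 - a * q ^ k) ≤ 1 + w a * w q ^ k := by
  rw [sub_eq_add_neg]
  refine (hw.add_le _ _).trans (add_le_add hw.one_le ((hw.neg_le _).trans ((hw.mul_le _ _).trans ?_)))
  exact mul_le_mul_of_nonneg_left (hw.pow_le _ _) (hw.nonneg _)

theorem geomGrowth_pow (hw : IsSummabilityNorm w) (x : S) : GeomGrowth w fun n => x ^ n :=
  ⟨1, 1 + w x, zero_le_one, by linarith [hw.nonneg x], fun n => by
    rw [one_mul]
    exact (hw.pow_le x n).trans (pow_le_pow_left₀ (hw.nonneg x) (by linarith) n)⟩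

theorem geomGrowth_const (hw : IsSummabilityNorm w) (x : S) : GeomGrowth w fun _ => x :=
  ⟨w x, 1, hw.nonneg x, le_rfl, fun n => by simp⟩

theorem geomGrowth_mul (hw : IsSummabilityNorm w) {a b : ℕ → S} (ha : GeomGrowth w a)
    (hb : GeomGrowth w b) : GeomGrowth w fun n => a n * b n := by
  obtain ⟨M, K, hM, hK, h⟩ := ha
  obtain ⟨M', K', hM', hK', h'⟩ := hb
  refine ⟨M * M', K * K', mul_nonneg hM hM', one_le_mul_of_one_le_of_one_le hK hK', fun n => ?_⟩
  refine (hw.mul_le _ _).trans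
    ((mul_le_mul (h n) (h' n) (hw.nonneg _) (by positivity)).trans_eq ?_)
  rw [mul_pow]; ring

theorem geomGrowth_add (hw : IsSummabilityNorm w) {a b : ℕ → S} (ha : GeomGrowth w a)
    (hb : GeomGrowth w b) : GeomGrowth w fun n => a n + b n := by
  obtain ⟨M, K, hM, hK, h⟩ := ha
  obtain ⟨M', K', hM', hK', h'⟩ := hb
  refine ⟨M + M', K * K', add_nonneg hM hM', one_le_mul_of_one_le_of_one_le hK hK', fun n => ?_⟩
  have h1 : K ^ n ≤ (K * K') ^ n :=
    pow_le_pow_left₀ (by linarith) (le_mul_of_one_le_right (by linarith) hK') n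
  have h2 : K' ^ n ≤ (K * K') ^ n :=
    pow_le_pow_left₀ (by linarith) (le_mul_of_one_le_left (by linarith) hK) n
  refine (hw.add_le _ _).trans ((add_le_add (h n) (h' n)).trans ?_)
  rw [add_mul]
  exact add_le_add (mul_le_mul_of_nonneg_left h1 hM) (mul_le_mul_of_nonneg_left h2 hM')

theorem geomGrowth_qPoch (hw : IsSummabilityNorm w) (a : S) {q : S} (hq : w q < 1) :
    GeomGrowth w fun n => qPoch a q n := by
  refine ⟨1, 1 + w a, zero_le_one, by linarith [hw.nonneg a], fun n => ?_⟩
  rw [one_mul]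
  change w (qPoch a q n) ≤ _
  induction n with
  | zero => simpa [qPoch_zero] using hw.one_le
  | succ n ih =>
    rw [qPoch_succ, pow_succ]
    refine (hw.mul_le _ _).trans (mul_le_mul ih ((hw.one_sub_mul_pow_le a q n).trans ?_)
      (hw.nonneg _) (pow_nonneg (by linarith [hw.nonneg a]) _))
    have := mul_le_mul_of_nonneg_left (pow_le_one₀ (n := n) (hw.nonneg q) hq.le) (hw.nonneg a)
    linarith

/-- Each factor is at most 1 + x ≤ exp x with x = w(a) w(q)^k, and the x's form a convergent
geometric series. The bound is uniform in n, unlike `geomGrowth_qPoch`. -/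
theorem qPoch_bounded (hw : IsSummabilityNorm w) (a : S) {q : S} (hq : w q < 1) :
    ∃ P, ∀ n, w (qPoch a q n) ≤ P := by
  refine ⟨Real.exp (w a * (1 - w q)⁻¹), fun n => ?_⟩
  have h1 : w (qPoch a q n) ≤ Real.exp (∑ k ∈ Finset.range n, w a * w q ^ k) := by
    induction n with
    | zero => simpa [qPoch_zero] using hw.one_le
    | succ n ih =>
      rw [qPoch_succ, Finset.sum_range_succ, Real.exp_add]
      refine (hw.mul_le _ _).trans (mul_le_mul ih ((hw.one_sub_mul_pow_le a q n).trans ?_)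
        (hw.nonneg _) (Real.exp_pos _).le)
      linarith [Real.add_one_le_exp (w a * w q ^ n)]
  refine h1.trans (Real.exp_le_exp.2 ?_)
  rw [← Finset.mul_sum, ← tsum_geometric_of_lt_one (hw.nonneg q) hq]
  exact mul_le_mul_of_nonneg_left ((summable_geometric_of_lt_one (hw.nonneg q) hq).sum_le_tsum _
    fun i _ => pow_nonneg (hw.nonneg q) _) (hw.nonneg a)

theorem geomGrowth₂_mul (hw : IsSummabilityNorm w) {f g : ℕ × ℕ → S} (ha : GeomGrowth₂ w f)
    (hb : GeomGrowth₂ w g) : GeomGrowth₂ w fun p => f p * g p := by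
  obtain ⟨M, K, hM, hK, h⟩ := ha
  obtain ⟨M', K', hM', hK', h'⟩ := hb
  refine ⟨M * M', K * K', mul_nonneg hM hM', one_le_mul_of_one_le_of_one_le hK hK', fun n => ?_⟩
  refine (hw.mul_le _ _).trans
    ((mul_le_mul (h n) (h' n) (hw.nonneg _) (by positivity)).trans_eq ?_)
  rw [mul_pow]; ring

/-- Absolute summability of a double family with a quadratic exponent of `q`. -/
theorem summable_pow_mul (hw : IsSummabilityNorm w) {q : S} (hq : w q < 1) {f : ℕ × ℕ → S}
    (hf : GeomGrowth₂ w f) {k : ℕ × ℕ → ℕ} (hk : ∀ p, triangular p.1 + triangular p.2 ≤ k p) :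
    Summable fun p => w (q ^ k p * f p) := by
  obtain ⟨M, K, hM, hK, h⟩ := hf
  have hs := Real.summable_pow_mul_pow_triangular K (hw.nonneg q) hq
  have hnn : ∀ n, 0 ≤ K ^ n * w q ^ triangular n := fun n =>
    mul_nonneg (pow_nonneg (by linarith) _) (pow_nonneg (hw.nonneg q) _)
  -- The majorant M K^{m+n} r^{T_m+T_n}, with r = w(q), factors into two convergent single series.
  refine Summable.of_nonneg_of_le (fun p => hw.nonneg _) (fun p => ?_)
    ((hs.mul_of_nonneg hs hnn hnn).mul_left M)
  have h1 : w (q ^ k p) ≤ w q ^ triangular p.1 * w q ^ triangular p.2 := by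
    rw [← pow_add]
    exact (hw.pow_le _ _).trans (pow_le_pow_of_le_one (hw.nonneg q) hq.le (hk p))
  refine (hw.mul_le _ _).trans ((mul_le_mul h1 (h p) (hw.nonneg _)
    (mul_nonneg (pow_nonneg (hw.nonneg q) _) (pow_nonneg (hw.nonneg q) _))).trans_eq ?_)
  rw [pow_add]; ring

theorem summable_prod_right (hw : IsSummabilityNorm w) {f : ℕ × ℕ → S}
    (hf : Summable fun p => w (f p)) (i : ℕ) : Summable fun j => f (i, j) :=
  hw.summable _ (hf.comp_injective (Prod.mk_right_injective i))

theorem summable_prod_left (hw : IsSummabilityNorm w) {f : ℕ × ℕ → S}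
    (hf : Summable fun p => w (f p)) (j : ℕ) : Summable fun i => f (i, j) :=
  hw.summable _ (hf.comp_injective (Prod.mk_left_injective j))

theorem summable_pow_mul_single (hw : IsSummabilityNorm w) {q : S} (hq : w q < 1) {a : ℕ → S}
    (ha : GeomGrowth w a) : Summable fun n => w (q ^ triangular n * a n) := by
  obtain ⟨M, K, hM, hK, h⟩ := ha
  have := hw.summable_pow_mul hq (f := fun p => a p.1)
    (k := fun p => triangular p.1 + triangular p.2)
    ⟨M, K, hM, hK, fun p => (h p.1).trans (mul_le_mul_of_nonneg_left
      (pow_le_pow_right₀ hK (Nat.le_add_right _ _)) hM)⟩ fun p => le_rfl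
  simpa [Function.comp_def] using this.comp_injective (Prod.mk_left_injective 0)

end IsSummabilityNorm

theorem GeomGrowth.comp_prod {S : Type*} {w : S → ℝ} {a : ℕ → S} (ha : GeomGrowth w a) (D : ℕ)
    {φ : ℕ × ℕ → ℕ} (hφ : ∀ p, φ p ≤ D + (p.1 + p.2)) : GeomGrowth₂ w fun p => a (φ p) := by
  obtain ⟨M, K, hM, hK, h⟩ := ha
  refine ⟨M * K ^ D, K, by positivity, hK, fun p => (h _).trans ?_⟩
  rw [mul_assoc, ← pow_add]
  exact mul_le_mul_of_nonneg_left (pow_le_pow_right₀ hK (hφ p)) hM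

theorem GeomGrowth.fst {S : Type*} {w : S → ℝ} {a : ℕ → S} (ha : GeomGrowth w a) :
    GeomGrowth₂ w fun p => a p.1 :=
  ha.comp_prod 0 fun p => by omega

theorem GeomGrowth.snd {S : Type*} {w : S → ℝ} {a : ℕ → S} (ha : GeomGrowth w a) :
    GeomGrowth₂ w fun p => a p.2 :=
  ha.comp_prod 0 fun p => by omega

/-! ### The auxiliary series and the finite q-binomial theorem -/

/-- `e n = 1 / (q; q)_n`, expressed by its recursion. -/
structure IsInvQFactorial {S : Type*} [CommRing S] (q : S) (e : ℕ → S) : Prop where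
  zero : e 0 = 1
  succ : ∀ n, e (n + 1) * (1 - q ^ (n + 1)) = e n

/-- Euler's series for `(y q; q)_∞`, with `e n = 1 / (q; q)_n`. -/
noncomputable def eulerSeries {S : Type*} [CommRing S] [TopologicalSpace S] (e : ℕ → S)
    (y q : S) : S :=
  ∑' n : ℕ, q ^ triangular n * ((-y) ^ n * e n)

/-- The series `∑ n, c^n q^{T_n + T_{n+d}} / ((q; q)_n (q; q)_{n+d})`. -/
noncomputable def besselSeries {S : Type*} [CommRing S] [TopologicalSpace S] (e : ℕ → S)
    (c q : S) (d : ℕ) : S :=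
  ∑' n : ℕ, q ^ (triangular n + triangular (n + d)) * (c ^ n * (e n * e (n + d)))

/-- The series `∑ i, (-1)^i q^{T_{i+d}+i} (c; q)_i / (q; q)_i`. -/
noncomputable def heineSeries {S : Type*} [CommRing S] [TopologicalSpace S] (e : ℕ → S)
    (c q : S) (d : ℕ) : S :=
  ∑' i : ℕ, q ^ (triangular (i + d) + i) * ((-1) ^ i * (qPoch c q i * e i))

theorem le_triangular_add (a b : ℕ) : triangular a + triangular b ≤ triangular (a + b) := by
  rw [triangular_add]; exact Nat.le_add_right _ _

section Algebra

variable {S : Type*} [CommRing S] {q : S} {e : ℕ → S}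

theorem IsInvQFactorial.qPoch_mul (he : IsInvQFactorial q e) (n : ℕ) : qPoch q q n * e n = 1 := by
  induction n with
  | zero => simp [qPoch_zero, he.zero]
  | succ n ih =>
    rw [qPoch_succ]
    linear_combination qPoch q q n * he.succ n + ih

theorem IsInvQFactorial.of_qPoch_mul (h : ∀ n, qPoch q q n * e n = 1) : IsInvQFactorial q e where
  zero := by simpa [qPoch_zero] using h 0
  succ n := by
    have h1 := h (n + 1)
    rw [qPoch_succ] at h1
    linear_combination e n * h1 - e (n + 1) * (1 - q ^ (n + 1)) * h n

/-- The `q`-binomial theorem, divided by `(q; q)_N`. -/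
theorem IsInvQFactorial.sum_antidiagonal (he : IsInvQFactorial q e) (c : S) (N : ℕ) :
    ∑ p ∈ Finset.HasAntidiagonal.antidiagonal N, (-c) ^ p.1 * q ^ (triangular p.1 + p.2) * (e p.1 * e p.2) =
      q ^ N * (qPoch c q N * e N) := by
  induction N with
  | zero => simp [he.zero, qPoch_zero]
  | succ N ih =>
    set f : ℕ × ℕ → S := fun p => (-c) ^ p.1 * q ^ (triangular p.1 + p.2) * (e p.1 * e p.2) with hf
    have h1 : ∑ p ∈ Finset.HasAntidiagonal.antidiagonal (N + 1), f p * (1 - q ^ p.2) =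
        q * ∑ p ∈ Finset.HasAntidiagonal.antidiagonal N, f p := by
      rw [Finset.Nat.sum_antidiagonal_succ', Finset.mul_sum]
      simp only [pow_zero, sub_self, mul_zero, zero_add]
      refine Finset.sum_congr rfl fun p _ => ?_
      simp only [hf, ← he.succ p.2]
      ring
    have h2 : ∑ p ∈ Finset.HasAntidiagonal.antidiagonal (N + 1), f p * (q ^ p.2 * (1 - q ^ p.1)) =
        -c * q ^ (N + 1) * ∑ p ∈ Finset.HasAntidiagonal.antidiagonal N, f p := by
      rw [Finset.Nat.sum_antidiagonal_succ, Finset.mul_sum]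
      simp only [pow_zero, sub_self, mul_zero, zero_add]
      refine Finset.sum_congr rfl fun p hp => ?_
      rw [← Finset.HasAntidiagonal.mem_antidiagonal.1 hp]
      simp only [hf, ← he.succ p.1, triangular_succ]
      ring
    -- For m + n = N + 1, 1 - q^{N+1} = (1 - q^n) + q^n (1 - q^m); each piece lowers one of e_n,
    -- e_m, so both reduce to the sum for N.
    have h3 : (∑ p ∈ Finset.HasAntidiagonal.antidiagonal (N + 1), f p) * (1 - q ^ (N + 1)) =
        ∑ p ∈ Finset.HasAntidiagonal.antidiagonal (N + 1), f p * (1 - q ^ p.2) +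
          ∑ p ∈ Finset.HasAntidiagonal.antidiagonal (N + 1), f p * (q ^ p.2 * (1 - q ^ p.1)) := by
      rw [← Finset.sum_add_distrib, Finset.sum_mul]
      refine Finset.sum_congr rfl fun p hp => ?_
      rw [← Finset.HasAntidiagonal.mem_antidiagonal.1 hp]
      ring
    rw [h1, h2, ih, ← he.succ N] at h3
    have h4 := he.qPoch_mul (N + 1)
    rw [qPoch_succ] at h4 ⊢
    -- By `h4`, 1 - q^{N+1} has inverse e_{N+1} (q;q)_N, which cancels it from `h3`.
    linear_combination e (N + 1) * qPoch q q N * h3 +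
      (q ^ (N + 1) * qPoch c q N * (1 - c * q ^ N) * e (N + 1) -
        ∑ p ∈ Finset.HasAntidiagonal.antidiagonal (N + 1), f p) * h4

end Algebra

/-! ### Euler's expansion and the relation between J_d and H_d -/

section Analysis

variable {S : Type*} [CommRing S] [TopologicalSpace S] {w : S → ℝ} {q : S} {e : ℕ → S}

theorem summable_eulerSeries (hw : IsSummabilityNorm w) (hq : w q < 1) (hg : GeomGrowth w e)
    (y : S) : Summable fun n : ℕ => q ^ triangular n * ((-y) ^ n * e n) :=
  hw.summable _ (hw.summable_pow_mul_single hq (hw.geomGrowth_mul (hw.geomGrowth_pow _) hg))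

/-- Since T_{n+d} ≥ T_n + T_d, the exponent is quadratic in d as well as in n, which absorbs any
geometrically growing weight u_d. -/
theorem summable_norm_besselSeries (hw : IsSummabilityNorm w) (hq : w q < 1)
    (hg : GeomGrowth w e) (c : S) {u : ℕ → S} (hu : GeomGrowth w u) :
    Summable fun p : ℕ × ℕ => w (q ^ (triangular p.2 + triangular (p.2 + p.1)) *
      (u p.1 * (c ^ p.2 * (e p.2 * e (p.2 + p.1))))) := by
  refine hw.summable_pow_mul hq (hw.geomGrowth₂_mul hu.fst (hw.geomGrowth₂_mul
    (hw.geomGrowth_pow c).snd (hw.geomGrowth₂_mul hg.snd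
      (hg.comp_prod 0 fun p => by omega)))) fun p => ?_
  have := le_triangular_add p.2 p.1
  show triangular p.1 + triangular p.2 ≤ _
  omega

theorem summable_besselSeries (hw : IsSummabilityNorm w) (hq : w q < 1)
    (hg : GeomGrowth w e) (c : S) (d : ℕ) :
    Summable fun n : ℕ => q ^ (triangular n + triangular (n + d)) *
      (c ^ n * (e n * e (n + d))) := by
  simpa using hw.summable_prod_right
    (summable_norm_besselSeries hw hq hg c (hw.geomGrowth_const 1)) d

variable [IsTopologicalRing S] [T2Space S]

theorem eulerSeries_eq_mul (hw : IsSummabilityNorm w) (hq : w q < 1) (he : IsInvQFactorial q e)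
    (hg : GeomGrowth w e) (y : S) :
    eulerSeries e y q = (1 - y * q) * eulerSeries e (y * q) q := by
  have h1 := summable_eulerSeries hw hq hg y
  have h2 := summable_eulerSeries hw hq hg (y * q)
  have h3 : eulerSeries e y q - eulerSeries e (y * q) q = (-(y * q)) * eulerSeries e (y * q) q := by
    unfold eulerSeries
    rw [← h1.tsum_sub h2, (h1.sub h2).tsum_eq_zero_add, ← h2.tsum_mul_left]
    simp only [pow_zero, sub_self, zero_add]
    refine tsum_congr fun n => ?_
    rw [← he.succ n, triangular_succ]
    ring
  linear_combination h3

theorem eulerSeries_eq_qPoch_mul (hw : IsSummabilityNorm w) (hq : w q < 1)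
    (he : IsInvQFactorial q e) (hg : GeomGrowth w e) (y : S) (N : ℕ) :
    eulerSeries e y q = qPoch (y * q) q N * eulerSeries e (y * q ^ N) q := by
  induction N with
  | zero => simp [qPoch_zero]
  | succ N ih =>
    rw [ih, eulerSeries_eq_mul hw hq he hg (y * q ^ N), qPoch_succ]
    ring_nf

/-- Iterating E(y) = (1 - yq) E(yq) gives E(y) = (yq;q)_N E(yq^N), and the constant term of E(yq^N)
is 1. It remains to make (yq;q)_N (E(yq^N) - 1) vanish in the limit. -/
theorem tendsto_qPoch (hw : IsSummabilityNorm w) (hq : w q < 1)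
    (he : IsInvQFactorial q e) (hg : GeomGrowth w e) (y : S) :
    Tendsto (fun N : ℕ => qPoch (y * q) q N) atTop (𝓝 (eulerSeries e y q)) := by
  obtain ⟨P, hP⟩ := hw.qPoch_bounded (y * q) hq
  set a : ℕ → S := fun n => q ^ triangular n * ((-y) ^ n * e n) with ha
  set f : ℕ × ℕ → S := fun p => qPoch (y * q) q p.1 * q ^ (p.1 * (p.2 + 1)) * a (p.2 + 1) with hf
  have hP0 : 0 ≤ P := (hw.nonneg _).trans (hP 0)
  have hsa : Summable fun n => w (a (n + 1)) :=
    (hw.summable_pow_mul_single hq (hw.geomGrowth_mul (hw.geomGrowth_pow (-y)) hg)).comp_injective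
      (add_left_injective 1)
  have hfw : Summable fun p => w (f p) := by
    refine Summable.of_nonneg_of_le (fun p => hw.nonneg _) (fun p => ?_)
      (((summable_geometric_of_lt_one (hw.nonneg q) hq).mul_of_nonneg hsa
        (fun n => pow_nonneg (hw.nonneg q) _) (fun n => hw.nonneg _)).mul_left P)
    have h1 : w (q ^ (p.1 * (p.2 + 1))) ≤ w q ^ p.1 :=
      (hw.pow_le _ _).trans (pow_le_pow_of_le_one (hw.nonneg q) hq.le
        (Nat.le_mul_of_pos_right _ (Nat.succ_pos _)))
    have h2 : w (qPoch (y * q) q p.1 * q ^ (p.1 * (p.2 + 1))) ≤ P * w q ^ p.1 :=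
      (hw.mul_le _ _).trans (mul_le_mul (hP _) h1 (hw.nonneg _) hP0)
    exact (hw.mul_le _ _).trans ((mul_le_mul_of_nonneg_right h2 (hw.nonneg _)).trans_eq
      (mul_assoc _ _ _))
  -- The remainder at N is a row sum of the summable family `f`; row sums are then summable in N,
  -- hence tend to 0. No continuity of `w` or of the Euler series is needed.
  have hfs := hw.summable f hfw
  have hsum := (hfs.hasSum.prod_fiberwise fun i =>
    (hw.summable_prod_right hfw i).hasSum).summable.tendsto_atTop_zero
  have key : ∀ N, qPoch (y * q) q N = eulerSeries e y q - ∑' n, f (N, n) := by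
    intro N
    rw [eulerSeries_eq_qPoch_mul hw hq he hg y N, eulerSeries,
      (summable_eulerSeries hw hq hg _).tsum_eq_zero_add, mul_add,
      ← ((summable_nat_add_iff 1).2 (summable_eulerSeries hw hq hg _)).tsum_mul_left]
    have : ∀ n, qPoch (y * q) q N * (q ^ triangular (n + 1) *
        ((-(y * q ^ N)) ^ (n + 1) * e (n + 1))) = f (N, n) := by
      intro n
      simp only [hf, ha]
      rw [← neg_mul, mul_pow, ← pow_mul]
      ring
    simp only [this]
    simp [he.zero]
  simp only [key]
  simpa using hsum.const_sub (eulerSeries e y q)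

theorem qPochInf_eq_eulerSeries (hw : IsSummabilityNorm w) (hq : w q < 1)
    (he : IsInvQFactorial q e) (hg : GeomGrowth w e) (y : S) :
    qPochInf (y * q) q = eulerSeries e y q :=
  (tendsto_qPoch hw hq he hg y).limUnder_eq

/-- This is (q;q)_∞ / (q;q)_M = (q^{M+1};q)_∞. -/
theorem eulerSeries_one_mul (hw : IsSummabilityNorm w) (hq : w q < 1)
    (he : IsInvQFactorial q e) (hg : GeomGrowth w e) (M : ℕ) :
    eulerSeries e 1 q * e M = eulerSeries e (q ^ M) q := by
  have h := eulerSeries_eq_qPoch_mul hw hq he hg 1 M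
  rw [one_mul, one_mul] at h
  linear_combination e M * h + eulerSeries e (q ^ M) q * he.qPoch_mul M

theorem summable_mul_besselSeries (hw : IsSummabilityNorm w) (hq : w q < 1)
    (hg : GeomGrowth w e) (c : S) {u : ℕ → S} (hu : GeomGrowth w u) :
    Summable (fun d => u d * besselSeries e c q d) ∧
    ∑' p : ℕ × ℕ, q ^ (triangular p.2 + triangular (p.2 + p.1)) *
      (u p.1 * (c ^ p.2 * (e p.2 * e (p.2 + p.1)))) = ∑' d, u d * besselSeries e c q d := by
  have h := summable_norm_besselSeries hw hq hg c hu
  have h1 := (hw.summable _ h).hasSum.prod_fiberwise fun i => (hw.summable_prod_right h i).hasSum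
  have h2 : ∀ d, ∑' n, q ^ (triangular n + triangular (n + d)) *
      (u d * (c ^ n * (e n * e (n + d)))) = u d * besselSeries e c q d := by
    intro d
    rw [besselSeries, ← (summable_besselSeries hw hq hg c d).tsum_mul_left]
    exact tsum_congr fun n => by ring
  simp only [h2] at h1
  exact ⟨h1.summable, h1.tsum_eq.symm⟩

theorem tsum_eq_tsum_sum_antidiagonal {f : ℕ × ℕ → S} (hf : Summable f) :
    ∑' p, f p = ∑' N, ∑ p ∈ Finset.HasAntidiagonal.antidiagonal N, f p := by
  have hs : HasSum (fun x : (n : ℕ) × Finset.HasAntidiagonal.antidiagonal n => f x.2)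
      (∑' p, f p) :=
    Finset.HasAntidiagonal.sigmaAntidiagonalEquivProd.hasSum_iff.2 hf.hasSum
  refine ((hs.sigma fun N => hasSum_fintype _).tsum_eq.symm).trans (tsum_congr fun N => ?_)
  exact Finset.sum_coe_sort (Finset.HasAntidiagonal.antidiagonal N) f

theorem besselSeries_add_succ (hw : IsSummabilityNorm w) (hq : w q < 1)
    (he : IsInvQFactorial q e) (hg : GeomGrowth w e) (c : S) (d : ℕ) :
    eulerSeries e 1 q * besselSeries e c q d + eulerSeries e 1 q * besselSeries e c q (d + 1) =
      heineSeries e c q d := by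
  set f : ℕ × ℕ → S := fun p =>
    q ^ (triangular p.1 + triangular (p.1 + d) + triangular p.2 + p.2 * (p.1 + d + 1)) *
      ((-1) ^ p.2 * (c ^ p.1 * (e p.1 * e p.2))) with hf
  have hfw : Summable fun p => w (f p) := by
    refine hw.summable_pow_mul hq (hw.geomGrowth₂_mul (hw.geomGrowth_pow (-1)).snd
      (hw.geomGrowth₂_mul (hw.geomGrowth_pow c).fst (hw.geomGrowth₂_mul hg.fst hg.snd)))
      fun p => ?_
    show triangular p.1 + triangular p.2 ≤ _
    generalize p.2 * _ = x
    omega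
  have hfs := hw.summable f hfw
  have hb := summable_besselSeries hw hq hg c d
  have hb' := summable_besselSeries hw hq hg c (d + 1)
  have h1 : eulerSeries e 1 q * besselSeries e c q d +
      eulerSeries e 1 q * besselSeries e c q (d + 1) = ∑' p, f p := by
    rw [← mul_add, besselSeries, besselSeries, ← hb.tsum_add hb',
      ← (hb.add hb').tsum_mul_left,
      ← (hfs.hasSum.prod_fiberwise fun i => (hw.summable_prod_right hfw i).hasSum).tsum_eq]
    refine tsum_congr fun n => ?_
    -- With M = n + d + 1, e_{M-1} = (1 - q^M) e_M and T_M = T_{M-1} + M, so the q^M parts cancel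
    -- and one term in e_M survives; Euler's series then expands (q;q)_∞ e_M.
    have h2 : eulerSeries e 1 q * (q ^ (triangular n + triangular (n + d)) *
        (c ^ n * (e n * e (n + d))) + q ^ (triangular n + triangular (n + (d + 1))) *
        (c ^ n * (e n * e (n + (d + 1))))) = q ^ (triangular n + triangular (n + d)) *
        (c ^ n * e n) * (eulerSeries e 1 q * e (n + d + 1)) := by
      rw [← add_assoc n d 1, triangular_succ, ← he.succ (n + d)]
      ring
    rw [h2, eulerSeries_one_mul hw hq he hg, eulerSeries,
      ← (summable_eulerSeries hw hq hg _).tsum_mul_left]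
    refine tsum_congr fun m => ?_
    rw [neg_pow, ← pow_mul]
    ring
  rw [h1, tsum_eq_tsum_sum_antidiagonal hfs, heineSeries]
  refine tsum_congr fun N => ?_
  -- On n + m = N the exponent equals T_{N+d} + T_n + m, so what remains is the finite q-binomial
  -- sum.
  have h3 : ∑ p ∈ Finset.HasAntidiagonal.antidiagonal N, f p =
      ∑ p ∈ Finset.HasAntidiagonal.antidiagonal N, q ^ triangular (N + d) * (-1) ^ N *
        ((-c) ^ p.1 * q ^ (triangular p.1 + p.2) * (e p.1 * e p.2)) := by
    refine Finset.sum_congr rfl fun p hp => ?_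
    obtain ⟨n, m⟩ := p
    obtain rfl := Finset.HasAntidiagonal.mem_antidiagonal.1 hp
    have hs : ((-1 : S) ^ n) * (-1) ^ n = 1 := by rw [← mul_pow]; simp
    have h4 : q ^ (triangular n + triangular (n + d) + triangular m + m * (n + d + 1)) =
        q ^ triangular (n + m + d) * q ^ (triangular n + m) := by
      rw [← pow_add, triangular_add (n + m), triangular_add n d, triangular_add n m]
      ring
    simp only [hf]
    rw [h4, neg_pow c, pow_add (-1)]
    linear_combination (-(q ^ triangular (n + m + d) * q ^ (triangular n + m) * ((-1) ^ m *
      (c ^ n * (e n * e m))))) * hs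
  rw [h3, ← Finset.mul_sum, he.sum_antidiagonal c N]
  ring

end Analysis

/-! ### The product of two Euler series and the two-parameter identity -/

/-- Splitting `ℕ × ℕ` along the diagonal: `(m, n) = (n + d, n)` or `(m, n) = (m, m + d + 1)`. -/
def natProdEquivSum : (ℕ × ℕ) ⊕ (ℕ × ℕ) ≃ ℕ × ℕ where
  toFun := Sum.elim (fun p => (p.2 + p.1, p.2)) (fun p => (p.2, p.2 + (p.1 + 1)))
  invFun p := if p.2 ≤ p.1 then Sum.inl (p.1 - p.2, p.2) else Sum.inr (p.2 - p.1 - 1, p.1)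
  left_inv := by
    rintro (⟨d, n⟩ | ⟨d, n⟩)
    · simp
    · have h : ¬ n + (d + 1) ≤ n := by omega
      simp only [Sum.elim_inr, h, if_false]
      congr 2
      omega
  right_inv := by
    rintro ⟨m, n⟩
    by_cases h : n ≤ m
    · simp [h]
    · simp only [h, if_false, Sum.elim_inr]
      congr 1
      omega

section

variable {S : Type*} [CommRing S] [TopologicalSpace S] [IsTopologicalRing S] [T2Space S]
  {w : S → ℝ} {q : S} {e : ℕ → S}

theorem eulerSeries_mul (hw : IsSummabilityNorm w) (hq : w q < 1) (hg : GeomGrowth w e)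
    (A B : S) :
    eulerSeries e (-A) q * eulerSeries e (-B) q = besselSeries e (A * B) q 0 +
      ∑' d : ℕ, (A ^ (d + 1) + B ^ (d + 1)) * besselSeries e (A * B) q (d + 1) := by
  set f : ℕ × ℕ → S := fun p => (q ^ triangular p.1 * (A ^ p.1 * e p.1)) *
    (q ^ triangular p.2 * (B ^ p.2 * e p.2)) with hf
  have hfw : Summable fun p => w (f p) := by
    refine (hw.summable_pow_mul hq (hw.geomGrowth₂_mul (hw.geomGrowth₂_mul
      (hw.geomGrowth_pow A).fst hg.fst) (hw.geomGrowth₂_mul (hw.geomGrowth_pow B).snd hg.snd))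
      fun p => le_rfl).congr fun p => congrArg w ?_
    simp only [hf]
    ring
  have hfs := hw.summable f hfw
  have hA := summable_eulerSeries hw hq hg (-A)
  have hB := summable_eulerSeries hw hq hg (-B)
  simp only [neg_neg] at hA hB
  obtain ⟨sA, tA⟩ := summable_mul_besselSeries hw hq hg (A * B) (hw.geomGrowth_pow A)
  obtain ⟨sB, -⟩ := summable_mul_besselSeries hw hq hg (A * B)
    (u := fun d => B ^ d) (hw.geomGrowth_pow B)
  have h1 : Summable fun p : ℕ × ℕ => f (p.2 + p.1, p.2) :=
    hw.summable _ (hfw.comp_injective (natProdEquivSum.injective.comp Sum.inl_injective))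
  have h2 : Summable fun p : ℕ × ℕ => f (p.2, p.2 + (p.1 + 1)) :=
    hw.summable _ (hfw.comp_injective (natProdEquivSum.injective.comp Sum.inr_injective))
  have h3 : ∑' p, f p = (∑' p : ℕ × ℕ, f (p.2 + p.1, p.2)) +
      ∑' p : ℕ × ℕ, f (p.2, p.2 + (p.1 + 1)) := by
    rw [← natProdEquivSum.tsum_eq f]
    exact (HasSum.sum (f := fun x => f (natProdEquivSum x)) h1.hasSum h2.hasSum).tsum_eq
  -- A^{n+d} B^n = A^d (AB)^n. The diagonal d = 0 is counted here, so the B half starts at d + 1.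
  have h4 : ∑' p : ℕ × ℕ, f (p.2 + p.1, p.2) = ∑' d, A ^ d * besselSeries e (A * B) q d := by
    rw [← tA]
    refine tsum_congr fun p => ?_
    simp only [hf]
    ring
  have hwB := (summable_norm_besselSeries hw hq hg (A * B) (hw.geomGrowth_pow B)).comp_injective
    (i := fun p : ℕ × ℕ => (p.1 + 1, p.2)) fun p p' h => by simpa [Prod.ext_iff] using h
  have h5 : ∑' p : ℕ × ℕ, f (p.2, p.2 + (p.1 + 1)) =
      ∑' d, B ^ (d + 1) * besselSeries e (A * B) q (d + 1) := by
    rw [← ((hw.summable _ hwB).hasSum.prod_fiberwise fun i =>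
      (hw.summable_prod_right hwB i).hasSum).tsum_eq.symm.trans (tsum_congr fun d => ?_)]
    · refine tsum_congr fun p => ?_
      simp only [hf]
      ring
    · rw [besselSeries, ← (summable_besselSeries hw hq hg (A * B) (d + 1)).tsum_mul_left]
      refine tsum_congr fun n => ?_
      ring
  have hsA := (summable_nat_add_iff 1).2 sA
  have hsB := (summable_nat_add_iff 1).2 sB
  simp only [add_mul]
  rw [hsA.tsum_add hsB, ← h5, ← add_assoc]
  rw [sA.tsum_eq_zero_add] at h4
  simp only [pow_zero, one_mul] at h4
  rw [← h4, ← h3]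
  simp only [eulerSeries, neg_neg]
  exact hA.tsum_mul_tsum hB hfs

theorem tsum_mul_heineSeries (hw : IsSummabilityNorm w) (hq : w q < 1)
    (he : IsInvQFactorial q e) (hg : GeomGrowth w e) (A B : S) {u : ℕ → S}
    (hu : GeomGrowth w u) (hu0 : u 0 = 1) (hu1 : ∀ j, u (j + 1) + u j = A ^ (j + 1) + B ^ (j + 1)) :
    ∑' j, u j * heineSeries e (A * B) q j =
      eulerSeries e (-A) q * eulerSeries e (-B) q * eulerSeries e 1 q := by
  obtain ⟨s0, -⟩ := summable_mul_besselSeries hw hq hg (A * B) hu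
  obtain ⟨sA, -⟩ := summable_mul_besselSeries hw hq hg (A * B) (hw.geomGrowth_pow A)
  obtain ⟨sB, -⟩ := summable_mul_besselSeries hw hq hg (A * B) (hw.geomGrowth_pow B)
  have hs1 := (summable_nat_add_iff 1).2 s0
  -- The recursion writes u_j as A^{j+1} + B^{j+1} - u_{j+1}, reducing to series already known to
  -- converge.
  have hs2 : Summable fun j => u j * besselSeries e (A * B) q (j + 1) := by
    refine ((((summable_nat_add_iff 1).2 sA).add ((summable_nat_add_iff 1).2 sB)).sub hs1).congr
      fun j => ?_
    linear_combination (-besselSeries e (A * B) q (j + 1)) * hu1 j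
  have h1 : ∀ j, u j * heineSeries e (A * B) q j = eulerSeries e 1 q *
      (u j * besselSeries e (A * B) q j + u j * besselSeries e (A * B) q (j + 1)) := by
    intro j
    rw [← besselSeries_add_succ hw hq he hg]
    ring
  simp only [h1]
  rw [(s0.add hs2).tsum_mul_left, s0.tsum_add hs2, s0.tsum_eq_zero_add, hu0, add_assoc,
    ← hs1.tsum_add hs2, eulerSeries_mul hw hq hg, one_mul, mul_comm]
  simp only [← hu1, add_mul]

/-- Invertibility enters as explicit equations because K⟦X⟧ is not a field: `⁻¹` is a true inverse
there only on units. -/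
theorem twoParamSum_eq [Inv S] (hw : IsSummabilityNorm w) (hq : w q < 1) {A B : S}
    (hA : (1 + A) * (1 + A)⁻¹ = 1) (hB : (1 + B) * (1 + B)⁻¹ = 1)
    (he : ∀ n, qPoch q q n * (qPoch q q n)⁻¹ = 1) (hg : GeomGrowth w fun n => (qPoch q q n)⁻¹) :
    Summable (firstTerm A B q) ∧ Summable (secondTerm A B q) ∧
      (∀ c ∈ ({-(A * q), -(B * q), q} : Set S),
        Tendsto (fun N : ℕ => qPoch c q N) atTop (𝓝 (qPochInf c q))) ∧
      twoParamSum A B q = qPochInf (-(A * q)) q * qPochInf (-(B * q)) q * qPochInf q q := by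
  set e : ℕ → S := fun n => (qPoch q q n)⁻¹ with hedef
  have he' : IsInvQFactorial q e := .of_qPoch_mul he
  have hlim : ∀ y, Tendsto (fun N : ℕ => qPoch (y * q) q N) atTop (𝓝 (qPochInf (y * q) q)) := by
    intro y
    rw [qPochInf_eq_eulerSeries hw hq he' hg]
    exact tendsto_qPoch hw hq he' hg y
  have hcoef : GeomGrowth w fun i => (-1) ^ i * (qPoch (A * B) q i * e i) :=
    hw.geomGrowth_mul (hw.geomGrowth_pow (-1)) (hw.geomGrowth_mul (hw.geomGrowth_qPoch _ hq) hg)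
  have hk : ∀ p : ℕ × ℕ, triangular p.1 + triangular p.2 ≤ triangular (p.1 + p.2) + p.1 :=
    fun p => (le_triangular_add _ _).trans (Nat.le_add_right _ _)
  have hsum : ∀ {v : ℕ → S}, GeomGrowth w v → Summable fun p : ℕ × ℕ => w
      (q ^ (triangular (p.1 + p.2) + p.1) *
        (((-1) ^ p.1 * (qPoch (A * B) q p.1 * e p.1)) * v p.2)) :=
    fun hv => hw.summable_pow_mul hq (hw.geomGrowth₂_mul hcoef.fst hv.snd) hk
  have hpow : ∀ x : S, GeomGrowth w fun j => x ^ (1 + j) * (1 + x)⁻¹ := by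
    intro x
    simp only [pow_add, pow_one]
    exact hw.geomGrowth_mul (hw.geomGrowth_mul (hw.geomGrowth_const x) (hw.geomGrowth_pow x))
      (hw.geomGrowth_const _)
  have hv1 := hw.geomGrowth_add (hpow A) (hpow B)
  -- The sequence here is u_j; its (-1)^j component, which solves the homogeneous recursion, is
  -- fixed by u_0 = 1.
  have hu := hw.geomGrowth_add hv1 (hw.geomGrowth_mul
    (hw.geomGrowth_const ((1 - A * B) * ((1 + A)⁻¹ * (1 + B)⁻¹))) (hw.geomGrowth_pow (-1)))
  have hs1 : Summable (firstTerm A B q) := by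
    refine (hw.summable _ (hsum hv1)).congr fun p => ?_
    simp only [firstTerm, hedef]
    ring
  have hs2 : Summable (secondTerm A B q) := by
    refine (hw.summable _ (hsum (hw.geomGrowth_pow (-1)))).congr fun p => ?_
    simp only [secondTerm, hedef]
    ring
  refine ⟨hs1, hs2, ?_, ?_⟩
  · rintro c (rfl | rfl | rfl)
    · simpa only [neg_mul] using hlim (-A)
    · simpa only [neg_mul] using hlim (-B)
    · simpa only [one_mul] using hlim 1
  have hAe := qPochInf_eq_eulerSeries hw hq he' hg (-A)
  have hBe := qPochInf_eq_eulerSeries hw hq he' hg (-B)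
  have h1e := qPochInf_eq_eulerSeries hw hq he' hg 1
  rw [neg_mul] at hAe hBe
  rw [one_mul] at h1e
  rw [hAe, hBe, h1e, ← tsum_mul_heineSeries hw hq he' hg A B hu
    (by linear_combination (1 + (1 + B)⁻¹ - (1 + B) * (1 + B)⁻¹) * hA + (1 + A)⁻¹ * hB)
    (fun j => by linear_combination A ^ (1 + j) * hA + B ^ (1 + j) * hB), twoParamSum,
    ← hs2.tsum_mul_left, ← hs1.tsum_add (hs2.mul_left _)]
  -- The indices are swapped so that j is outermost and the inner sum over i is H_j.
  have hws := (hsum hu).comp_injective (Equiv.prodComm ℕ ℕ).injective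
  rw [← (Equiv.prodComm ℕ ℕ).tsum_eq, ← ((hw.summable _ hws).hasSum.prod_fiberwise fun j =>
      (hw.summable_prod_right hws j).hasSum).tsum_eq.symm.trans (tsum_congr fun j => ?_)]
  · refine tsum_congr fun p => ?_
    simp only [firstTerm, secondTerm, Equiv.prodComm_apply, Prod.fst_swap, Prod.snd_swap, hedef]
    ring
  · have hh := hw.summable_prod_left (hsum (hw.geomGrowth_const 1)) j
    simp only [mul_one] at hh
    rw [heineSeries, ← hh.tsum_mul_left]
    refine tsum_congr fun i => ?_
    simp only [Equiv.prodComm_apply, Prod.swap_prod_mk]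
    ring

end

/-! ### Specialization to Jacobi's triple product -/

theorem jacobi_specialization {S : Type*} [CommRing S] [TopologicalSpace S] [Inv S] {z q : S}
    (hz : z * z⁻¹ = 1) (hz1 : (1 + z) * (1 + z)⁻¹ = 1)
    (hz2 : (1 + z⁻¹) * (1 + z⁻¹)⁻¹ = 1) (he : qPoch q q 0 * (qPoch q q 0)⁻¹ = 1)
    (hs : Summable (firstTerm z z⁻¹ q)) :
    Summable (jacobiTerm z q) ∧ twoParamSum z z⁻¹ q = ∑' j : ℕ, jacobiTerm z q j := by
  have hz3 : (1 + z⁻¹)⁻¹ = z * (1 + z)⁻¹ := by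
    linear_combination (-(1 + z⁻¹)⁻¹) * hz1 + z * (1 + z)⁻¹ * hz2 -
      (1 + z)⁻¹ * (1 + z⁻¹)⁻¹ * hz
  rw [qPoch_zero, one_mul] at he
  have h0 : ∀ p, p ∉ Set.range (Prod.mk (0 : ℕ) : ℕ → ℕ × ℕ) → firstTerm z z⁻¹ q p = 0 := by
    rintro ⟨i, j⟩ h
    have hi : i ≠ 0 := by rintro rfl; exact h ⟨j, rfl⟩
    have : qPoch (z * z⁻¹) q i = 0 :=
      Finset.prod_eq_zero (Finset.mem_range.2 (Nat.pos_of_ne_zero hi)) (by simp [hz])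
    simp [firstTerm, this]
  have h1 : firstTerm z z⁻¹ q ∘ Prod.mk 0 = jacobiTerm z q := by
    funext j
    simp only [Function.comp_apply, firstTerm, jacobiTerm, qPoch_zero, hz3, zero_add, add_zero, he]
    linear_combination q ^ triangular j * z⁻¹ ^ j * (1 + z)⁻¹ * hz
  have hinj := Prod.mk_right_injective (β := ℕ) (0 : ℕ)
  refine ⟨h1 ▸ (hinj.summable_iff h0).2 hs, ?_⟩
  rw [twoParamSum, hz, sub_self, zero_mul, zero_mul, add_zero, ← h1]
  exact (hinj.tsum_eq fun p hp => by_contra fun h => hp (h0 p h)).symm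

/-! ### The complex setting -/

theorem isSummabilityNorm_norm {S : Type*} [NormedCommRing S] [NormOneClass S] [CompleteSpace S] :
    IsSummabilityNorm (fun x : S => ‖x‖) where
  nonneg := norm_nonneg
  add_le := norm_add_le
  mul_le := norm_mul_le
  neg_le x := (norm_neg x).le
  one_le := norm_one.le
  summable _ h := h.of_norm

theorem qPoch_self_ne_zero {𝕜 : Type*} [NormedField 𝕜] {q : 𝕜} (hq : ‖q‖ < 1) (n : ℕ) :
    qPoch q q n ≠ 0 := by
  refine Finset.prod_ne_zero_iff.2 fun k _ h => ?_
  have h1 : ‖q ^ (k + 1)‖ = 1 := by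
    rw [pow_succ', ← sub_eq_zero.1 h, norm_one]
  rw [norm_pow] at h1
  exact (pow_lt_one₀ (norm_nonneg q) hq k.succ_ne_zero).ne h1

theorem geomGrowth_inv_qPoch_self {𝕜 : Type*} [NormedField 𝕜] {q : 𝕜} (hq : ‖q‖ < 1) :
    GeomGrowth (fun x : 𝕜 => ‖x‖) fun n => (qPoch q q n)⁻¹ := by
  have h0 : 0 < 1 - ‖q‖ := sub_pos.2 hq
  -- Every factor satisfies |1 - q^{k+1}| ≥ 1 - |q|.
  refine ⟨1, (1 - ‖q‖)⁻¹, zero_le_one, (one_le_inv₀ h0).2 (by linarith [norm_nonneg q]),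
    fun n => ?_⟩
  change ‖(qPoch q q n)⁻¹‖ ≤ _
  rw [one_mul, norm_inv, inv_pow]
  refine inv_anti₀ (pow_pos h0 n) ?_
  induction n with
  | zero => simp [qPoch_zero]
  | succ n ih =>
    rw [qPoch_succ, norm_mul, pow_succ]
    refine mul_le_mul ih ?_ h0.le (norm_nonneg _)
    have h1 : ‖q * q ^ n‖ ≤ ‖q‖ := by
      rw [norm_mul, norm_pow]
      exact mul_le_of_le_one_right (norm_nonneg q) (pow_le_one₀ (norm_nonneg q) hq.le)
    have h2 := norm_sub_norm_le (1 : 𝕜) (q * q ^ n)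
    rw [norm_one] at h2
    linarith

/-! ### The formal power series setting -/

open Classical in
/-- The `X`-adic absolute value `2^{-order}` of a formal power series. -/
noncomputable def PowerSeries.adicAbs {K : Type*} [Semiring K] (f : K⟦X⟧) : ℝ :=
  if f = 0 then 0 else (1 / 2) ^ f.order.toNat

section

variable {K : Type*}

@[simp]
theorem PowerSeries.adicAbs_zero [Semiring K] : (0 : K⟦X⟧).adicAbs = 0 :=
  if_pos rfl

theorem PowerSeries.adicAbs_nonneg [Semiring K] (f : K⟦X⟧) : 0 ≤ f.adicAbs := by
  unfold adicAbs
  split_ifs <;> positivity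

theorem PowerSeries.adicAbs_le_iff [Semiring K] (f : K⟦X⟧) (n : ℕ) :
    f.adicAbs ≤ (1 / 2) ^ n ↔ (n : ℕ∞) ≤ f.order := by
  unfold adicAbs
  split_ifs with h
  · simp [h]
  · rw [pow_le_pow_iff_right_of_lt_one₀ (by norm_num) (by norm_num)]
    obtain ⟨m, hm⟩ := ENat.ne_top_iff_exists.1 (mt PowerSeries.order_eq_top.1 h)
    simp [← hm]

theorem PowerSeries.adicAbs_eq [Semiring K] {f : K⟦X⟧} (hf : f ≠ 0) :
    ∃ n : ℕ, f.order = n ∧ f.adicAbs = (1 / 2) ^ n := by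
  obtain ⟨m, hm⟩ := ENat.ne_top_iff_exists.1 (mt PowerSeries.order_eq_top.1 hf)
  exact ⟨m, hm.symm, by simp [adicAbs, hf, ← hm]⟩

theorem PowerSeries.adicAbs_le_one [Semiring K] (f : K⟦X⟧) : f.adicAbs ≤ 1 := by
  simpa using (f.adicAbs_le_iff 0).2 (by simp)

theorem PowerSeries.adicAbs_mul_le [Semiring K] (f g : K⟦X⟧) :
    (f * g).adicAbs ≤ f.adicAbs * g.adicAbs := by
  by_cases hf : f = 0
  · simp [hf]
  by_cases hg : g = 0
  · simp [hg]
  obtain ⟨m, hm, hm'⟩ := adicAbs_eq hf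
  obtain ⟨n, hn, hn'⟩ := adicAbs_eq hg
  rw [hm', hn', ← pow_add, adicAbs_le_iff, Nat.cast_add, ← hm, ← hn]
  exact PowerSeries.le_order_mul f g

theorem PowerSeries.adicAbs_add_le [Semiring K] (f g : K⟦X⟧) :
    (f + g).adicAbs ≤ f.adicAbs + g.adicAbs := by
  by_cases hf : f = 0
  · simp [hf]
  by_cases hg : g = 0
  · simp [hg]
  obtain ⟨m, hm, hm'⟩ := adicAbs_eq hf
  obtain ⟨n, hn, hn'⟩ := adicAbs_eq hg
  have h := PowerSeries.min_order_le_order_add f g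
  rcases le_total m n with hmn | hmn
  · refine le_add_of_le_of_nonneg ?_ (adicAbs_nonneg g)
    rw [hm', adicAbs_le_iff]
    refine le_trans ?_ h
    simp [hm, hn, hmn]
  · refine le_add_of_nonneg_of_le (adicAbs_nonneg f) ?_
    rw [hn', adicAbs_le_iff]
    refine le_trans ?_ h
    simp [hm, hn, hmn]

theorem PowerSeries.isSummabilityNorm_adicAbs [CommRing K] [TopologicalSpace K] :
    IsSummabilityNorm (PowerSeries.adicAbs (K := K)) where
  nonneg := adicAbs_nonneg
  add_le := adicAbs_add_le
  mul_le := adicAbs_mul_le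
  neg_le f := by
    by_cases hf : f = 0
    · rw [hf, neg_zero]
    obtain ⟨m, hm, hm'⟩ := adicAbs_eq hf
    rw [hm', adicAbs_le_iff, PowerSeries.order_neg, hm]
  one_le := adicAbs_le_one 1
  summable f h := by
    rw [PowerSeries.WithPiTopology.summable_iff_summable_coeff]
    intro n
    -- Absolute value below 2^{-n} forces order at least n + 1, so all but finitely many terms have
    -- zero n-th coefficient.
    have h1 : ∀ᶠ i in cofinite, (f i).adicAbs < (1 / 2) ^ n :=
      h.tendsto_cofinite_zero.eventually_lt_const (by positivity)
    refine summable_of_hasFiniteSupport (Set.Finite.subset h1 fun i hi => ?_)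
    intro hlt
    have h2 := ((f i).adicAbs_le_iff (n + 1)).1 ?_
    · exact hi (PowerSeries.coeff_of_lt_order n (lt_of_lt_of_le (by exact_mod_cast n.lt_succ_self) h2))
    · have hlt' : (f i).adicAbs < (1 / 2) ^ n := hlt
      by_cases hf : f i = 0
      · rw [hf, adicAbs_zero]; positivity
      obtain ⟨m, -, hm⟩ := adicAbs_eq hf
      rw [hm] at hlt' ⊢
      rw [pow_lt_pow_iff_right_of_lt_one₀ (by norm_num) (by norm_num)] at hlt'
      exact pow_le_pow_of_le_one (by norm_num) (by norm_num) hlt'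

theorem PowerSeries.adicAbs_X_lt_one [Semiring K] [Nontrivial K] :
    (PowerSeries.X : K⟦X⟧).adicAbs < 1 := by
  refine ((PowerSeries.adicAbs_le_iff _ 1).2 ?_).trans_lt (by norm_num)
  simp [PowerSeries.order_X]

theorem PowerSeries.qPoch_X_mul_inv [Field K] (n : ℕ) :
    qPoch (PowerSeries.X : K⟦X⟧) PowerSeries.X n *
      (qPoch (PowerSeries.X : K⟦X⟧) PowerSeries.X n)⁻¹ = 1 := by
  refine PowerSeries.mul_inv_cancel _ ?_
  simp [qPoch, map_prod]

/-- Growth is automatic here, as every power series has absolute value at most 1. -/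
theorem PowerSeries.geomGrowth_adicAbs [Semiring K] (a : ℕ → K⟦X⟧) :
    GeomGrowth PowerSeries.adicAbs a :=
  ⟨1, 1, zero_le_one, le_rfl, fun n => by simpa using (a n).adicAbs_le_one⟩

theorem PowerSeries.one_add_C_mul_inv [Field K] {a : K} (ha : 1 + a ≠ 0) :
    (1 + PowerSeries.C a) * (1 + PowerSeries.C a)⁻¹ = 1 :=
  PowerSeries.mul_inv_cancel _ (by simpa using ha)

end

theorem one_add_inv_ne_zero {K : Type*} [Field K] {z : K} (hz : z ≠ 0) (hz1 : 1 + z ≠ 0) :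
    1 + z⁻¹ ≠ 0 := by
  intro h
  apply hz1
  field_simp at h
  linear_combination h

theorem mainTheorem4 :
    -- the two-parameter identity for formal power series in `q = X` over a field
    (∀ (K : Type*) [Field K] [TopologicalSpace K] [DiscreteTopology K] (a b : K),
      1 + a ≠ 0 → 1 + b ≠ 0 →
      ∀ A B q : K⟦X⟧, A = PowerSeries.C a → B = PowerSeries.C b → q = PowerSeries.X →
        Summable (firstTerm A B q) ∧ Summable (secondTerm A B q) ∧
        (∀ c ∈ ({-(A * q), -(B * q), q} : Set K⟦X⟧),
          Tendsto (fun N : ℕ => qPoch c q N) atTop (𝓝 (qPochInf c q))) ∧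
        twoParamSum A B q =
          qPochInf (-(A * q)) q * qPochInf (-(B * q)) q * qPochInf q q) ∧
    -- its specialization `A = 1 / B = z`: Jacobi's triple product, formally
    (∀ (K : Type*) [Field K] [TopologicalSpace K] [DiscreteTopology K] (ζ : K),
      ζ ≠ 0 → 1 + ζ ≠ 0 →
      ∀ z q : K⟦X⟧, z = PowerSeries.C ζ → q = PowerSeries.X →
        Summable (jacobiTerm z q) ∧
        twoParamSum z z⁻¹ q = ∑' j : ℕ, jacobiTerm z q j ∧
        ∑' j : ℕ, jacobiTerm z q j =
          qPochInf (-(q * z)) q * qPochInf (-(q * z⁻¹)) q * qPochInf q q) ∧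
    -- the two-parameter identity for complex `A`, `B`, `q` with `|q| < 1`
    (∀ A B q : ℂ, 1 + A ≠ 0 → 1 + B ≠ 0 → ‖q‖ < 1 →
        Summable (firstTerm A B q) ∧ Summable (secondTerm A B q) ∧
        (∀ c ∈ ({-(A * q), -(B * q), q} : Set ℂ),
          Tendsto (fun N : ℕ => qPoch c q N) atTop (𝓝 (qPochInf c q))) ∧
        twoParamSum A B q =
          qPochInf (-(A * q)) q * qPochInf (-(B * q)) q * qPochInf q q) ∧
    -- its specialization `A = 1 / B = z`: Jacobi's triple product, for complex numbers
    (∀ z q : ℂ, z ≠ 0 → 1 + z ≠ 0 → ‖q‖ < 1 →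
        Summable (jacobiTerm z q) ∧
        twoParamSum z z⁻¹ q = ∑' j : ℕ, jacobiTerm z q j ∧
        ∑' j : ℕ, jacobiTerm z q j =
          qPochInf (-(q * z)) q * qPochInf (-(q * z⁻¹)) q * qPochInf q q) := by
  have complex : ∀ A B q : ℂ, 1 + A ≠ 0 → 1 + B ≠ 0 → ‖q‖ < 1 → _ :=
    fun A B q hA hB hq =>
      twoParamSum_eq isSummabilityNorm_norm hq (mul_inv_cancel₀ hA) (mul_inv_cancel₀ hB)
        (fun n => mul_inv_cancel₀ (qPoch_self_ne_zero hq n)) (geomGrowth_inv_qPoch_self hq)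
  refine ⟨?_, ?_, complex, ?_⟩
  · rintro K _ _ _ a b ha hb A B q rfl rfl rfl
    exact twoParamSum_eq (PowerSeries.isSummabilityNorm_adicAbs (K := K))
      PowerSeries.adicAbs_X_lt_one
      (PowerSeries.one_add_C_mul_inv ha) (PowerSeries.one_add_C_mul_inv hb)
      PowerSeries.qPoch_X_mul_inv (PowerSeries.geomGrowth_adicAbs _)
  · rintro K _ _ _ ζ hζ hζ1 z q rfl rfl
    have hC : (PowerSeries.C ζ : K⟦X⟧)⁻¹ = PowerSeries.C ζ⁻¹ := PowerSeries.C_inv ζ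
    have hz2 := PowerSeries.one_add_C_mul_inv (one_add_inv_ne_zero hζ hζ1)
    rw [← hC] at hz2
    obtain ⟨hs, -, -, h⟩ := twoParamSum_eq (PowerSeries.isSummabilityNorm_adicAbs (K := K))
      PowerSeries.adicAbs_X_lt_one (PowerSeries.one_add_C_mul_inv hζ1) hz2
      PowerSeries.qPoch_X_mul_inv (PowerSeries.geomGrowth_adicAbs _)
    obtain ⟨hj, he⟩ := jacobi_specialization (PowerSeries.mul_inv_cancel _ (by simpa using hζ))
      (PowerSeries.one_add_C_mul_inv hζ1) hz2 (PowerSeries.qPoch_X_mul_inv 0) hs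
    refine ⟨hj, he, ?_⟩
    rw [← he, h, mul_comm (PowerSeries.C ζ), mul_comm (PowerSeries.C ζ)⁻¹]
  · intro z q hz hz1 hq
    obtain ⟨hs, -, -, h⟩ := complex z z⁻¹ q hz1 (one_add_inv_ne_zero hz hz1) hq
    obtain ⟨hj, he⟩ := jacobi_specialization (mul_inv_cancel₀ hz) (mul_inv_cancel₀ hz1)
      (mul_inv_cancel₀ (one_add_inv_ne_zero hz hz1))
      (mul_inv_cancel₀ (qPoch_self_ne_zero hq 0)) hs
    refine ⟨hj, he, ?_⟩
    rw [← he, h, mul_comm z, mul_comm z⁻¹]
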